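/- Let $X$ be a metrizable, locally compact, separable topological space, let $T\colon X\to X$ be continuous, and let $T^k$ denote the $k$-th iterate of $T$ (with $T^0=\mathrm{id}_X$). Then for every integer $k\ge 0$ $$h_{\mathrm{top}}(T^k)=k\cdot h_{\mathrm{top}}(T)$$ as an identity in $[0,\infty]$, with the convention $0\cdot\infty=0$. Here $h_{\mathrm{top}}$ is defined as follows. A family $\mathcal A$ of subsets of $X$ is a cover if its union is $X$, and $N(\mathcal A)\in\{0,1,2,\dots\}\cup\{\infty\}$ denotes the least cardinality of a subfamily of $\mathcal A$ which is still a cover. For covers $\mathcal A,\mathcal B$ put $\mathcal A\vee\mathcal B=\{A\cap B : A\in\mathcal A,\ B\in\mathcal B,\ A\cap B\ne\emptyset\}$ and $T^{-j}(\mathcal A)=\{(T^j)^{-1}(A):A\in\mathcal A\}$, and for $n\ge 1$ put $\mathcal A^n=\mathcal A\vee T^{-1}(\mathcal A)\vee\dots\vee T^{-(n-1)}(\mathcal A)$. An open cover is admissible if at least one of its members has compact complement in $X$. Then $$h(\mathcal A,T)=\lim_{n\to\infty}\frac1n\log N(\mathcal A^n),\qquad h_{\mathrm{top}}(T)=\sup_{\mathcal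 A\ \text{admissible}}h(\mathcal A,T),$$ where the limit always exists in $[0,\infty]$, and the entropy of the map of the empty space is taken to be $0$. -/

import Mathlib

open Set Filter Topology
open scoped ENNReal

namespace CoverEntropy

/-- A family of subsets of `X` is a cover of `X` when its union is all of `X`. -/
def IsCover {X : Type*} (A : Set (Set X)) : Prop :=
  ⋃₀ A = univ

/-- The least cardinality of a subcover of `A`, infinite cardinalities being identified with `⊤`. -/
noncomputable def minCard {X : Type*} (A : Set (Set X)) : ℕ∞ :=
  ⨅ (B : Set (Set X)) (_ : B ⊆ A ∧ IsCover B), B.encard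

/-- The common refinement `A ∨ B`: all nonempty intersections `a ∩ b`. -/
def join {X : Type*} (A B : Set (Set X)) : Set (Set X) :=
  {c | ∃ a ∈ A, ∃ b ∈ B, c = a ∩ b ∧ (a ∩ b).Nonempty}

/-- The family `T⁻ʲ(A)` of the preimages of the members of `A` under the `j`-th iterate of `T`. -/
def pull {X : Type*} (T : X → X) (j : ℕ) (A : Set (Set X)) : Set (Set X) :=
  (fun a => T^[j] ⁻¹' a) '' A

/-- The family `Aⁿ = A ∨ T⁻¹(A) ∨ ⋯ ∨ T⁻⁽ⁿ⁻¹⁾(A)`; for `n = 0`, which plays no role, this is the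
trivial cover. -/
def iter {X : Type*} (T : X → X) (A : Set (Set X)) : ℕ → Set (Set X)
  | 0 => {univ}
  | 1 => A
  | n + 2 => join (iter T A (n + 1)) (pull T (n + 1) A)

/-- The entropy `log N(A)` of a cover, in `[0, ∞]`, with `log ∞ = ∞`. If `X` is nonempty, every
cover has `N(A) ≥ 1`, so no negative logarithm is cut off; on the empty space, where `N(A) = 0`,
the value is `0`. -/
noncomputable def entropy {X : Type*} (A : Set (Set X)) : ℝ≥0∞ :=
  (ENNReal.log (minCard A : ℝ≥0∞)).toENNReal

/-- The entropy of `T` with respect to the cover `A`: the limit of `(1 / n) log N(Aⁿ)`. It is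
written as a `limsup`; that the limit exists for every cover is `tendsto_mapEntropy` below. -/
noncomputable def mapEntropy {X : Type*} (T : X → X) (A : Set (Set X)) : ℝ≥0∞ :=
  limsup (fun n : ℕ => entropy (iter T A n) / (n : ℝ≥0∞)) atTop

/-- An open cover is admissible when at least one of its members has compact complement. -/
def IsAdmissible {X : Type*} [TopologicalSpace X] (A : Set (Set X)) : Prop :=
  IsCover A ∧ (∀ a ∈ A, IsOpen a) ∧ ∃ a ∈ A, IsCompact aᶜ

/-- The topological entropy of `T`: the supremum over the admissible covers `A` of `X` of the
entropy of `T` with respect to `A`. -/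
noncomputable def topEntropy {X : Type*} [TopologicalSpace X] (T : X → X) : ℝ≥0∞ :=
  ⨆ (A : Set (Set X)) (_ : IsAdmissible A), mapEntropy T A

/-! ### The limit in the definition of `mapEntropy` exists -/

theorem exists_subcover {X : Type*} {A : Set (Set X)} (h : minCard A ≠ ⊤) :
    ∃ B, B ⊆ A ∧ IsCover B ∧ B.encard = minCard A := by
  have hne : Nonempty {B : Set (Set X) // B ⊆ A ∧ IsCover B} := by
    by_contra hc
    apply h
    rw [minCard, iInf_eq_top]
    intro B
    rw [iInf_eq_top]
    intro hB
    exact (hc ⟨⟨B, hB⟩⟩).elim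
  obtain ⟨⟨B, hB⟩, hE⟩ :=
    ciInf_mem (fun B : {B : Set (Set X) // B ⊆ A ∧ IsCover B} => (B : Set (Set X)).encard)
  refine ⟨B, hB.1, hB.2, ?_⟩
  rw [minCard, iInf_subtype']
  exact hE

theorem minCard_le {X : Type*} {A B : Set (Set X)} (h : B ⊆ A) (hB : IsCover B) :
    minCard A ≤ B.encard :=
  iInf₂_le B ⟨h, hB⟩

theorem inter_mem_iter {X : Type*} (T : X → X) (A : Set (Set X)) (m n : ℕ) {c d : Set X}
    (hc : c ∈ iter T A (m + 1)) (hd : d ∈ iter T A (n + 1))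
    (hne : (c ∩ T^[m + 1] ⁻¹' d).Nonempty) :
    c ∩ T^[m + 1] ⁻¹' d ∈ iter T A (m + 1 + (n + 1)) := by
  induction n generalizing d with
  | zero => exact ⟨c, hc, _, ⟨d, hd, rfl⟩, rfl, hne⟩
  | succ n ih =>
    obtain ⟨d', hd', _, ⟨a, ha, rfl⟩, rfl, -⟩ := hd
    have key : c ∩ T^[m + 1] ⁻¹' (d' ∩ T^[n + 1] ⁻¹' a)
        = (c ∩ T^[m + 1] ⁻¹' d') ∩ T^[m + 1 + (n + 1)] ⁻¹' a := by
      rw [add_comm (m + 1) (n + 1), Function.iterate_add T (n + 1) (m + 1), preimage_comp,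
        preimage_inter, inter_assoc]
    dsimp only at hne ⊢
    rw [key] at hne ⊢
    exact ⟨_, ih hd' (hne.mono inter_subset_left), _, ⟨a, ha, rfl⟩, rfl, hne⟩

theorem minCard_iter_add_le {X : Type*} (T : X → X) (A : Set (Set X)) (m n : ℕ)
    (hm : minCard (iter T A (m + 1)) ≠ ⊤) (hn : minCard (iter T A (n + 1)) ≠ ⊤) :
    minCard (iter T A (m + 1 + (n + 1)))
      ≤ minCard (iter T A (m + 1)) * minCard (iter T A (n + 1)) := by
  obtain ⟨C, hCA, hC, hCc⟩ := exists_subcover hm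
  obtain ⟨D, hDA, hD, hDc⟩ := exists_subcover hn
  set E : Set (Set X) := (fun p : Set X × Set X => p.1 ∩ T^[m + 1] ⁻¹' p.2) ''
    {p ∈ C ×ˢ D | (p.1 ∩ T^[m + 1] ⁻¹' p.2).Nonempty} with hE
  have hEA : E ⊆ iter T A (m + 1 + (n + 1)) := by
    rintro _ ⟨⟨c, d⟩, ⟨⟨hc, hd⟩, hne⟩, rfl⟩
    exact inter_mem_iter T A m n (hCA hc) (hDA hd) hne
  have hEc : IsCover E := by
    refine eq_univ_of_forall fun x => ?_
    obtain ⟨c, hc, hxc⟩ : x ∈ ⋃₀ C := hC ▸ mem_univ x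
    obtain ⟨d, hd, hxd⟩ : T^[m + 1] x ∈ ⋃₀ D := hD ▸ mem_univ _
    exact ⟨_, ⟨(c, d), ⟨⟨hc, hd⟩, ⟨x, hxc, hxd⟩⟩, rfl⟩, hxc, hxd⟩
  calc _ ≤ E.encard := minCard_le hEA hEc
    _ ≤ _ := encard_image_le _ _
    _ ≤ (C ×ˢ D).encard := encard_le_encard (sep_subset _ _)
    _ = _ := by rw [encard_prod, hCc, hDc]

theorem minCard_le_minCard_iter {X : Type*} (T : X → X) (A : Set (Set X)) (n : ℕ) :
    minCard A ≤ minCard (iter T A (n + 1)) := by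
  have hsub : ∀ n, ∀ c ∈ iter T A (n + 1), ∃ a ∈ A, c ⊆ a := by
    intro n
    induction n with
    | zero => exact fun c hc => ⟨c, hc, subset_rfl⟩
    | succ n ih =>
      rintro _ ⟨c, hc, _, -, rfl, -⟩
      obtain ⟨a, ha, hca⟩ := ih c hc
      exact ⟨a, ha, inter_subset_left.trans hca⟩
  rcases eq_or_ne (minCard (iter T A (n + 1))) ⊤ with h | h
  · rw [h]; exact le_top
  obtain ⟨C, hCA, hC, hCc⟩ := exists_subcover h
  choose! f hf hfs using hsub n
  rw [← hCc]
  refine (minCard_le (B := f '' C) ?_ ?_).trans (encard_image_le _ _)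
  · rintro _ ⟨c, hc, rfl⟩
    exact hf c (hCA hc)
  · refine eq_univ_of_forall fun x => ?_
    obtain ⟨c, hc, hxc⟩ : x ∈ ⋃₀ C := hC ▸ mem_univ x
    exact ⟨f c, mem_image_of_mem f hc, hfs c (hCA hc) hxc⟩

theorem entropy_of_ne_top {X : Type*} {A : Set (Set X)} (h : minCard A ≠ ⊤) :
    entropy A = ENNReal.ofReal (Real.log ((minCard A).toNat : ℝ)) := by
  obtain ⟨N, hN⟩ := ENat.ne_top_iff_exists.mp h
  rw [entropy, ← hN]
  rcases Nat.eq_zero_or_pos N with rfl | hpos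
  · simp
  · rw [ENat.toENNReal_coe, ENat.toNat_natCast,
      ENNReal.log_pos_real (by positivity) (ENNReal.natCast_ne_top N)]
    simp

/-- For every family `A`, in particular for every cover, `(1 / n) log N(Aⁿ)` converges in
`[0, ∞]`, with limit `mapEntropy T A`. -/
theorem tendsto_mapEntropy {X : Type*} (T : X → X) (A : Set (Set X)) :
    Tendsto (fun n : ℕ => entropy (iter T A n) / (n : ℝ≥0∞)) atTop (𝓝 (mapEntropy T A)) := by
  suffices h : ∃ l, Tendsto (fun n : ℕ => entropy (iter T A n) / (n : ℝ≥0∞)) atTop (𝓝 l) by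
    obtain ⟨l, hl⟩ := h
    rw [mapEntropy, hl.limsup_eq]
    exact hl
  rcases eq_or_ne (minCard A) ⊤ with hA | hA
  · refine ⟨⊤, tendsto_const_nhds.congr' ?_⟩
    filter_upwards [eventually_ge_atTop 1] with n hn
    obtain ⟨n, rfl⟩ := Nat.exists_eq_add_of_le' hn
    have h1 : minCard (iter T A (n + 1)) = ⊤ :=
      top_unique (hA ▸ minCard_le_minCard_iter T A n)
    rw [entropy, h1]
    simp [ENNReal.top_div]
  · have hfin : ∀ n, minCard (iter T A (n + 1)) ≠ ⊤ := by
      intro n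
      induction n with
      | zero => exact hA
      | succ n ih =>
        exact ne_top_of_le_ne_top (WithTop.mul_ne_top ih hA) (minCard_iter_add_le T A n 0 ih hA)
    have h0 : minCard (iter T A 0) ≤ 1 := by
      refine (minCard_le (B := {univ}) subset_rfl ?_).trans (by simp)
      simp [IsCover]
    have hu0 : Real.log ((minCard (iter T A 0)).toNat : ℝ) = 0 := by
      have : (minCard (iter T A 0)).toNat ≤ 1 := ENat.toNat_le_of_le_natCast h0
      interval_cases (minCard (iter T A 0)).toNat <;> simp
    set u : ℕ → ℝ := fun n => Real.log ((minCard (iter T A n)).toNat : ℝ) with hu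
    have hu_nonneg : ∀ n, 0 ≤ u n := fun n => Real.log_natCast_nonneg _
    have hsub : Subadditive u := by
      intro m n
      rcases m with _ | m
      · simp [hu, hu0]
      rcases n with _ | n
      · simp [hu, hu0]
      have hle := ENat.toNat_le_toNat (minCard_iter_add_le T A m n (hfin m) (hfin n))
        (WithTop.mul_ne_top (hfin m) (hfin n))
      rw [ENat.toNat_mul] at hle
      rcases Nat.eq_zero_or_pos (minCard (iter T A (m + 1 + (n + 1)))).toNat with hz | hz
      · have : u (m + 1 + (n + 1)) = 0 := by simp [hu, hz]
        rw [this]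
        exact add_nonneg (hu_nonneg _) (hu_nonneg _)
      · have hpos := hz.trans_le hle
        have h1 := Nat.pos_of_mul_pos_right hpos
        have h2 := Nat.pos_of_mul_pos_left hpos
        simp only [hu]
        rw [← Real.log_mul (by positivity) (by positivity)]
        exact Real.log_le_log (by exact_mod_cast hz) (by exact_mod_cast hle)
    have hlim := hsub.tendsto_lim
      ⟨0, by rintro _ ⟨n, rfl⟩; exact div_nonneg (hu_nonneg n) (Nat.cast_nonneg n)⟩
    refine ⟨_, (ENNReal.tendsto_ofReal hlim).congr' ?_⟩
    filter_upwards [eventually_ge_atTop 1] with n hn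
    obtain ⟨n, rfl⟩ := Nat.exists_eq_add_of_le' hn
    rw [entropy_of_ne_top (hfin n), ENNReal.ofReal_div_of_pos (by positivity),
      ENNReal.ofReal_natCast]

end CoverEntropy

namespace CoverEntropy

/-- The points whose orbit follows the word `f` during the first `n` steps. -/
def cylinder {X : Type*} (T : X → X) (n : ℕ) (f : ℕ → Set X) : Set X :=
  {x | ∀ i < n, T^[i] x ∈ f i}

/-- A set of words over `A` such that every orbit of length `n` follows one of them. -/
def IsWordCover {X : Type*} (T : X → X) (A : Set (Set X)) (n : ℕ) (F : Set (ℕ → Set X)) : Prop :=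
  (∀ f ∈ F, ∀ i, f i ∈ A) ∧ ∀ x, ∃ f ∈ F, x ∈ cylinder T n f

theorem cylinder_succ {X : Type*} (T : X → X) (n : ℕ) (f : ℕ → Set X) :
    cylinder T (n + 1) f = cylinder T n f ∩ T^[n] ⁻¹' f n := by
  ext x
  simp only [cylinder, mem_ofPred_eq, mem_inter_iff, mem_preimage, Nat.forall_lt_succ_right]

theorem cylinder_congr {X : Type*} (T : X → X) {n : ℕ} {f g : ℕ → Set X}
    (h : ∀ i < n, f i = g i) : cylinder T n f = cylinder T n g := by
  ext x
  exact forall₂_congr fun i hi => by rw [h i hi]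

theorem isOpen_cylinder {X : Type*} [TopologicalSpace X] {T : X → X} (hT : Continuous T) {n : ℕ}
    {f : ℕ → Set X} (hf : ∀ i, IsOpen (f i)) : IsOpen (cylinder T n f) := by
  induction n with
  | zero => simp [cylinder]
  | succ n ih =>
    rw [cylinder_succ]
    exact ih.inter ((hf n).preimage (hT.iterate n))

theorem exists_eq_cylinder {X : Type*} (T : X → X) (A : Set (Set X)) {n : ℕ} {c : Set X}
    (hc : c ∈ iter T A (n + 1)) : ∃ f : ℕ → Set X, (∀ i, f i ∈ A) ∧ c = cylinder T (n + 1) f := by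
  induction n generalizing c with
  | zero => exact ⟨fun _ => c, fun _ => hc, by simp [cylinder]⟩
  | succ n ih =>
    obtain ⟨d, hd, _, ⟨a, ha, rfl⟩, rfl, -⟩ := hc
    obtain ⟨f, hf, rfl⟩ := ih hd
    refine ⟨fun i => if i = n + 1 then a else f i, fun i => ?_, ?_⟩
    · dsimp only
      split_ifs
      exacts [ha, hf i]
    · rw [cylinder_succ T (n + 1)]
      congr 1
      · exact cylinder_congr T fun i hi => (if_neg hi.ne).symm
      · simp

theorem cylinder_mem_iter {X : Type*} (T : X → X) (A : Set (Set X)) {n : ℕ} {f : ℕ → Set X}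
    (hf : ∀ i, f i ∈ A) (hne : (cylinder T (n + 1) f).Nonempty) :
    cylinder T (n + 1) f ∈ iter T A (n + 1) := by
  induction n with
  | zero => simpa [cylinder, iter] using hf 0
  | succ n ih =>
    rw [cylinder_succ] at hne ⊢
    exact ⟨_, ih (hne.mono inter_subset_left), _, ⟨f (n + 1), hf _, rfl⟩, rfl, hne⟩

theorem IsWordCover.minCard_iter_le {X : Type*} {T : X → X} {A : Set (Set X)} {n : ℕ}
    {F : Set (ℕ → Set X)} (hF : IsWordCover T A (n + 1) F) :
    minCard (iter T A (n + 1)) ≤ F.encard := by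
  refine (minCard_le (B := cylinder T (n + 1) '' {f ∈ F | (cylinder T (n + 1) f).Nonempty})
    ?_ ?_).trans ((encard_image_le _ _).trans (encard_le_encard (sep_subset _ _)))
  · rintro _ ⟨f, ⟨hf, hne⟩, rfl⟩
    exact cylinder_mem_iter T A (hF.1 f hf) hne
  · refine eq_univ_of_forall fun x => ?_
    obtain ⟨f, hf, hx⟩ := hF.2 x
    exact ⟨_, ⟨f, ⟨hf, x, hx⟩, rfl⟩, hx⟩

theorem exists_isWordCover {X : Type*} (T : X → X) (A : Set (Set X)) (n : ℕ)
    (h : minCard (iter T A (n + 1)) ≠ ⊤) :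
    ∃ F, IsWordCover T A (n + 1) F ∧ F.encard ≤ minCard (iter T A (n + 1)) := by
  obtain ⟨C, hCA, hC, hcard⟩ := exists_subcover h
  choose! w hwA hw using fun c (hc : c ∈ iter T A (n + 1)) => exists_eq_cylinder T A hc
  refine ⟨w '' C, ⟨?_, fun x => ?_⟩, hcard ▸ encard_image_le _ _⟩
  · rintro _ ⟨c, hc, rfl⟩
    exact hwA c (hCA hc)
  · obtain ⟨c, hc, hx⟩ : x ∈ ⋃₀ C := hC ▸ mem_univ x
    exact ⟨w c, mem_image_of_mem w hc, hw c (hCA hc) ▸ hx⟩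

theorem minCard_iter_ne_top {X : Type*} (T : X → X) {A : Set (Set X)} (hA : minCard A ≠ ⊤)
    (n : ℕ) : minCard (iter T A (n + 1)) ≠ ⊤ := by
  induction n with
  | zero => exact hA
  | succ n ih =>
    exact ne_top_of_le_ne_top (WithTop.mul_ne_top ih hA) (minCard_iter_add_le T A n 0 ih hA)

theorem IsAdmissible.minCard_ne_top {X : Type*} [TopologicalSpace X] {A : Set (Set X)}
    (hA : IsAdmissible A) : minCard A ≠ ⊤ := by
  obtain ⟨hc, ho, u, hu, hK⟩ := hA
  obtain ⟨B, hBA, hB, hKB⟩ := hK.elim_finite_subcover_image (b := A) (c := id) ho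
    (by simp only [id, ← sUnion_eq_biUnion]; exact hc ▸ subset_univ _)
  have hfin : (insert u B).Finite := hB.insert u
  refine ne_top_of_le_ne_top hfin.encard_lt_top.ne (minCard_le (insert_subset hu hBA) ?_)
  refine eq_univ_of_forall fun x => ?_
  by_cases hx : x ∈ u
  · exact ⟨u, mem_insert _ _, hx⟩
  · obtain ⟨b, hb, hxb⟩ := mem_iUnion₂.mp (hKB hx)
    exact ⟨b, mem_insert_of_mem _ hb, hxb⟩

theorem entropy_le_add {X : Type*} {A B : Set (Set X)} (C q : ℕ)
    (h : minCard A ≤ minCard B * (C : ℕ∞) ^ q) :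
    entropy A ≤ entropy B + q * ENNReal.ofReal (Real.log C) := by
  rcases eq_or_ne (minCard B) ⊤ with hB | hB
  · simp [entropy, hB]
  have hAB : minCard B * (C : ℕ∞) ^ q ≠ ⊤ := by
    rw [← Nat.cast_pow]
    exact WithTop.mul_ne_top hB (ENat.natCast_ne_top _)
  have hA : minCard A ≠ ⊤ := ne_top_of_le_ne_top hAB h
  rw [entropy_of_ne_top hA, entropy_of_ne_top hB]
  have hle := ENat.toNat_le_toNat h hAB
  rw [ENat.toNat_mul, ← Nat.cast_pow, ENat.toNat_natCast] at hle
  rcases Nat.eq_zero_or_pos (minCard A).toNat with h0 | h0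
  · simp [h0]
  have hpos := h0.trans_le hle
  have h1 := Nat.pos_of_mul_pos_right hpos
  have h2 := Nat.pos_of_mul_pos_left hpos
  rw [← ENNReal.ofReal_natCast q, ← ENNReal.ofReal_mul (Nat.cast_nonneg q),
    ← ENNReal.ofReal_add (Real.log_natCast_nonneg _)
      (mul_nonneg (Nat.cast_nonneg q) (Real.log_natCast_nonneg _)), ← Real.log_pow,
    ← Nat.cast_pow, ← Real.log_mul (by positivity) (by positivity)]
  exact ENNReal.ofReal_le_ofReal (Real.log_le_log (by exact_mod_cast h0) (by exact_mod_cast hle))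

theorem entropy_mono {X : Type*} {A B : Set (Set X)} (h : minCard A ≤ minCard B) :
    entropy A ≤ entropy B := by
  simpa using entropy_le_add 1 0 (by simpa using h)

/-- Sampling the sequence defining `mapEntropy T A` along the multiples of `k`. -/
theorem tendsto_entropy_iter_mul {X : Type*} (T : X → X) (A : Set (Set X)) (k : ℕ) :
    Tendsto (fun n : ℕ => entropy (iter T A (n * (k + 1))) / (n : ℝ≥0∞)) atTop
      (𝓝 (((k + 1 : ℕ) : ℝ≥0∞) * mapEntropy T A)) := by
  have h := ENNReal.Tendsto.const_mul (a := ((k + 1 : ℕ) : ℝ≥0∞))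
    ((tendsto_mapEntropy T A).comp (tendsto_id.atTop_mul_const' (Nat.succ_pos k)))
    (Or.inr (ENNReal.natCast_ne_top _))
  refine h.congr fun n => ?_
  have h0 : ((k + 1 : ℕ) : ℝ≥0∞) ≠ 0 := by exact_mod_cast Nat.succ_ne_zero k
  simp only [Function.comp_apply, id]
  rw [Nat.cast_mul, mul_comm (n : ℝ≥0∞), ← mul_div_assoc,
    ENNReal.mul_div_mul_left _ _ h0 (ENNReal.natCast_ne_top _)]

theorem minCard_iter_iterate_le {X : Type*} (T : X → X) (A : Set (Set X)) (k n : ℕ) :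
    minCard (iter (T^[k + 1]) A (n + 1)) ≤ minCard (iter T A ((n + 1) * (k + 1))) := by
  rw [show (n + 1) * (k + 1) = n * (k + 1) + k + 1 by ring]
  rcases eq_or_ne (minCard (iter T A (n * (k + 1) + k + 1))) ⊤ with h | h
  · exact h ▸ le_top
  obtain ⟨F, hF, hcard⟩ := exists_isWordCover T A _ h
  refine le_trans ?_ ((encard_image_le (fun f i => f ((k + 1) * i)) F).trans hcard)
  refine IsWordCover.minCard_iter_le ⟨?_, fun x => ?_⟩
  · rintro _ ⟨f, hf, rfl⟩ i
    exact hF.1 f hf _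
  · obtain ⟨f, hf, hx⟩ := hF.2 x
    refine ⟨_, mem_image_of_mem _ hf, fun i hi => ?_⟩
    rw [← Function.iterate_mul]
    exact hx _ (by nlinarith)

theorem mapEntropy_iterate_le {X : Type*} (T : X → X) (A : Set (Set X)) (k : ℕ) :
    mapEntropy (T^[k + 1]) A ≤ ((k + 1 : ℕ) : ℝ≥0∞) * mapEntropy T A := by
  refine le_of_tendsto_of_tendsto (tendsto_mapEntropy _ A) (tendsto_entropy_iter_mul T A k) ?_
  filter_upwards [eventually_ge_atTop 1] with n hn
  obtain ⟨n, rfl⟩ := Nat.exists_eq_add_of_le' hn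
  exact ENNReal.div_le_div_right (entropy_mono (minCard_iter_iterate_le T A k n)) _

/-- The union of the first `m + 1` images of `s`. -/
def forwardImages {X : Type*} (T : X → X) (s : Set X) (m : ℕ) : Set X :=
  ⋃ j ∈ Finset.range (m + 1), T^[j] '' s

theorem isCompact_forwardImages {X : Type*} [TopologicalSpace X] {T : X → X} (hT : Continuous T)
    {s : Set X} (hs : IsCompact s) (m : ℕ) : IsCompact (forwardImages T s m) :=
  (Finset.range (m + 1)).isCompact_biUnion fun j _ => hs.image (hT.iterate j)

theorem iterate_mem_forwardImages {X : Type*} (T : X → X) {s : Set X} {k M j l : ℕ} {x : X}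
    (hx : T^[j] x ∈ s) (hj : j < k + 1) (hl : 1 ≤ l) (hlM : l ≤ M) :
    T^[(k + 1) * l] x ∈ forwardImages T s ((k + 1) * M) := by
  have h1 : k + 1 ≤ (k + 1) * l := Nat.le_mul_of_pos_right _ hl
  have h2 : (k + 1) * l ≤ (k + 1) * M := Nat.mul_le_mul_left _ hlM
  simp only [forwardImages, mem_iUnion]
  refine ⟨(k + 1) * l - j, Finset.mem_range.mpr (by omega), T^[j] x, hx, ?_⟩
  rw [← Function.iterate_add_apply, Nat.sub_add_cancel (by omega)]

/-- A block of length `k + 1` outside the forward images of `uᶜ` is coded by `u` alone unless it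
meets `uᶜ`, and this happens at most once in `M + 1` consecutive blocks. -/
theorem minCard_iter_mul_le {X : Type*} (T : X → X) {A : Set (Set X)} {u : Set X} (hu : u ∈ A)
    {k : ℕ} {G : Set (ℕ → Set X)} (hG : IsWordCover T A (k + 1) G) (M n : ℕ) :
    minCard (iter T A ((n + 1) * (k + 1))) ≤
      minCard (iter (T^[k + 1])
        (insert (forwardImages T uᶜ ((k + 1) * M))ᶜ (iter T A (k + 1))) (n + 1)) *
          G.encard ^ ((n + 1) / (M + 1) + 1) := by
  classical
  rw [show (n + 1) * (k + 1) = n * (k + 1) + k + 1 by ring]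
  set L := forwardImages T uᶜ ((k + 1) * M)
  set B := insert Lᶜ (iter T A (k + 1))
  set q := (n + 1) / (M + 1) + 1
  rcases isEmpty_or_nonempty X with hX | ⟨⟨x₀⟩⟩
  · refine (minCard_le (empty_subset _) (Subsingleton.elim _ _)).trans ?_
    simp
  have hG1 : G.encard ≠ 0 := by
    obtain ⟨g, hg, -⟩ := hG.2 x₀
    exact (encard_pos.mpr ⟨g, hg⟩).ne'
  rcases eq_or_ne (minCard (iter (T^[k + 1]) B (n + 1))) ⊤ with htop | htop
  · rw [htop, ENat.top_mul (pow_ne_zero _ hG1)]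
    exact le_top
  obtain ⟨F, hF, hcard⟩ := exists_isWordCover _ B n htop
  choose! w hwA hw using fun c (hc : c ∈ iter T A (k + 1)) => exists_eq_cylinder T A hc
  let R : (ℕ → Set X) → ℕ → Prop := fun g i =>
    g i = Lᶜ ∧ ∀ l, 1 ≤ l → l ≤ M → i + l < n + 1 → g (i + l) ≠ Lᶜ
  let code : (ℕ → Set X) × (Fin q → ℕ → Set X) → ℕ → Set X := fun p t =>
    if R p.1 (t / (k + 1)) ∧ t / (k + 1) < n + 1 then
      p.2 (Fin.ofNat q (t / (k + 1) / (M + 1))) (t % (k + 1))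
    else if p.1 (t / (k + 1)) = Lᶜ then u
    else w (p.1 (t / (k + 1))) (t % (k + 1))
  have hcount : (code '' (F ×ˢ univ.pi fun _ : Fin q => G)).encard ≤
      minCard (iter (T^[k + 1]) B (n + 1)) * G.encard ^ q := by
    refine (encard_image_le _ _).trans ?_
    rw [encard_prod]
    refine mul_le_mul' hcard (le_of_eq ?_)
    rw [encard_pi_eq_prod_encard, Finset.prod_const, Finset.card_univ, Fintype.card_fin]
  refine le_trans ?_ hcount
  refine IsWordCover.minCard_iter_le ⟨?_, fun x => ?_⟩
  · rintro _ ⟨⟨g, s⟩, ⟨hg, hs⟩, rfl⟩ t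
    simp only [code]
    split_ifs with h1 h2
    · exact hG.1 _ (hs _ (mem_univ _)) _
    · exact hu
    · exact hwA _ ((hF.1 g hg _).resolve_left h2) _
  obtain ⟨g, hg, hgx⟩ := hF.2 x
  choose v hvG hv using hG.2
  have hblock : ∀ i < n + 1, T^[(k + 1) * i] x ∈ g i := fun i hi => by
    rw [Function.iterate_mul]
    exact hgx i hi
  let s : Fin q → ℕ → Set X := fun b =>
    if h : ∃ i < n + 1, R g i ∧ i / (M + 1) = b then v (T^[(k + 1) * h.choose] x) else v x
  have hs : ∀ i < n + 1, R g i → s (Fin.ofNat q (i / (M + 1))) = v (T^[(k + 1) * i] x) := by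
    intro i hi hR
    have hval : ((Fin.ofNat q (i / (M + 1)) : Fin q) : ℕ) = i / (M + 1) :=
      Nat.mod_eq_of_lt (Nat.lt_succ_of_le (Nat.div_le_div_right hi.le))
    have h : ∃ i' < n + 1, R g i' ∧ i' / (M + 1) = (Fin.ofNat q (i / (M + 1)) : Fin q) :=
      ⟨i, hi, hR, hval.symm⟩
    obtain ⟨hi', hR', hd⟩ := h.choose_spec
    have hsep : ∀ a b, b < n + 1 → R g a → R g b → a / (M + 1) = b / (M + 1) → ¬ a < b := by
      intro a b hb ha hb' hab hlt
      have h1 := Nat.div_add_mod a (M + 1)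
      have h2 := Nat.div_add_mod b (M + 1)
      have h3 := Nat.mod_lt b (Nat.add_one_pos M)
      rw [hab] at h1
      have := ha.2 (b - a) (by omega) (by omega) (by omega)
      rw [Nat.add_sub_cancel' hlt.le] at this
      exact this hb'.1
    replace hd := hd.trans hval
    have heq : h.choose = i := le_antisymm (not_lt.mp (hsep _ _ hi' hR hR' hd.symm))
      (not_lt.mp (hsep _ _ hi hR' hR hd))
    simp only [s]
    rw [dif_pos h, heq]
  refine ⟨_, ⟨(g, s), ⟨hg, fun b _ => ?_⟩, rfl⟩, fun t ht => ?_⟩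
  · simp only [s]
    split_ifs <;> exact hvG _
  set i := t / (k + 1) with hi
  have hmod : t % (k + 1) < k + 1 := Nat.mod_lt t (Nat.succ_pos k)
  have hin : i < n + 1 := Nat.div_lt_of_lt_mul (by linarith)
  have hit : T^[t] x = T^[t % (k + 1)] (T^[(k + 1) * i] x) := by
    rw [← Function.iterate_add_apply, Nat.mod_add_div]
  simp only [code]
  rw [← hi, hit]
  split_ifs with h1 h2
  · rw [hs i hin h1.1]
    exact hv _ _ hmod
  · by_contra hxu
    refine h1 ⟨⟨h2, fun l hl hlM hil hgl => ?_⟩, hin⟩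
    have := hblock _ hil
    rw [hgl, mul_add, add_comm, Function.iterate_add_apply] at this
    exact this (iterate_mem_forwardImages T hxu hmod hl hlM)
  · have hmem := (hF.1 g hg i).resolve_left h2
    have := hblock i hin
    rw [hw _ hmem] at this
    exact this _ hmod

theorem IsAdmissible.insert_compl_iter {X : Type*} [TopologicalSpace X] [T2Space X] {T : X → X}
    (hT : Continuous T) {A : Set (Set X)} (hA : IsAdmissible A) {L : Set X} (hL : IsCompact L)
    (k : ℕ) : IsAdmissible (insert Lᶜ (iter T A (k + 1))) := by
  refine ⟨?_, ?_, Lᶜ, mem_insert _ _, by rwa [compl_compl]⟩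
  · obtain ⟨C, hCA, hC, -⟩ := exists_subcover (minCard_iter_ne_top T hA.minCard_ne_top k)
    exact univ_subset_iff.mp (hC ▸ sUnion_subset_sUnion (hCA.trans (subset_insert _ _)))
  · rintro a (rfl | ha)
    · exact hL.isClosed.isOpen_compl
    · obtain ⟨f, hf, rfl⟩ := exists_eq_cylinder T A ha
      exact isOpen_cylinder hT fun i => hA.2.1 _ (hf i)

theorem mul_mapEntropy_le_topEntropy_iterate {X : Type*} [TopologicalSpace X] [T2Space X]
    {T : X → X} (hT : Continuous T) {A : Set (Set X)} (hA : IsAdmissible A) (k : ℕ) :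
    ((k + 1 : ℕ) : ℝ≥0∞) * mapEntropy T A ≤ topEntropy (T^[k + 1]) := by
  have hfin := minCard_iter_ne_top T hA.minCard_ne_top k
  obtain ⟨G, hG, hcard⟩ := exists_isWordCover T A k hfin
  obtain ⟨C, hC⟩ := ENat.ne_top_iff_exists.mp (ne_top_of_le_ne_top hfin hcard)
  obtain ⟨u, hu, hK⟩ := hA.2.2
  set c := ENNReal.ofReal (Real.log C)
  have hM : ∀ M : ℕ, ((k + 1 : ℕ) : ℝ≥0∞) * mapEntropy T A ≤
      topEntropy (T^[k + 1]) + ((M + 1 : ℕ) : ℝ≥0∞)⁻¹ * c := by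
    intro M
    set B := insert (forwardImages T uᶜ ((k + 1) * M))ᶜ (iter T A (k + 1))
    have hBadm : IsAdmissible B :=
      hA.insert_compl_iter hT (isCompact_forwardImages hT hK _) k
    have hlim : Tendsto (fun n : ℕ => entropy (iter (T^[k + 1]) B n) / (n : ℝ≥0∞) +
        (((M + 1 : ℕ) : ℝ≥0∞)⁻¹ + (n : ℝ≥0∞)⁻¹) * c) atTop
        (𝓝 (mapEntropy (T^[k + 1]) B + (((M + 1 : ℕ) : ℝ≥0∞)⁻¹ + 0) * c)) :=
      (tendsto_mapEntropy _ B).add (ENNReal.Tendsto.mul_const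
        (tendsto_const_nhds.add ENNReal.tendsto_inv_nat_nhds_zero) (Or.inr ENNReal.ofReal_ne_top))
    rw [add_zero] at hlim
    refine le_trans ?_ (add_le_add_left (le_iSup₂_of_le B hBadm le_rfl) _)
    refine le_of_tendsto_of_tendsto (tendsto_entropy_iter_mul T A k) hlim ?_
    filter_upwards [eventually_ge_atTop 1] with n hn
    obtain ⟨n, rfl⟩ := Nat.exists_eq_add_of_le' hn
    have hle := minCard_iter_mul_le T hu hG M n
    rw [← hC] at hle
    refine (ENNReal.div_le_div_right (entropy_le_add C _ hle) _).trans ?_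
    rw [ENNReal.add_div]
    refine add_le_add_right ?_ _
    rw [mul_comm, mul_div_assoc, mul_comm]
    refine mul_le_mul_left ?_ _
    have h0 : ((n + 1 : ℕ) : ℝ≥0∞) ≠ 0 := by exact_mod_cast Nat.succ_ne_zero n
    have hM0 : ((M + 1 : ℕ) : ℝ≥0∞) ≠ 0 := by exact_mod_cast Nat.succ_ne_zero M
    rw [Nat.cast_add ((n + 1) / (M + 1)) 1, ENNReal.add_div, Nat.cast_one, one_div]
    refine add_le_add_left ?_ _
    refine ENNReal.div_le_of_le_mul ?_
    rw [mul_comm, ← div_eq_mul_inv, ENNReal.le_div_iff_mul_le (Or.inl hM0)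
      (Or.inl (ENNReal.natCast_ne_top _))]
    exact_mod_cast Nat.div_mul_le_self _ _
  have hlim : Tendsto (fun M : ℕ => topEntropy (T^[k + 1]) + ((M + 1 : ℕ) : ℝ≥0∞)⁻¹ * c) atTop
      (𝓝 (topEntropy (T^[k + 1]) + 0 * c)) :=
    tendsto_const_nhds.add (ENNReal.Tendsto.mul_const
      (ENNReal.tendsto_inv_nat_nhds_zero.comp (tendsto_add_atTop_nat 1))
      (Or.inr ENNReal.ofReal_ne_top))
  rw [zero_mul, add_zero] at hlim
  exact ge_of_tendsto' hlim hM

theorem mapEntropy_id {X : Type*} {A : Set (Set X)} (hA : minCard A ≠ ⊤) :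
    mapEntropy id A = 0 := by
  obtain ⟨C, hCA, hC, hcard⟩ := exists_subcover hA
  have hle : ∀ n, minCard (iter id A (n + 1)) ≤ minCard A := by
    intro n
    rw [← hcard]
    refine le_trans ?_ (encard_image_le (fun (a : Set X) (_ : ℕ) => a) C)
    refine IsWordCover.minCard_iter_le ⟨?_, fun x => ?_⟩
    · rintro _ ⟨a, ha, rfl⟩ i
      exact hCA ha
    · obtain ⟨a, ha, hx⟩ : x ∈ ⋃₀ C := hC ▸ mem_univ x
      exact ⟨_, mem_image_of_mem _ ha, fun i _ => by simpa using hx⟩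
  have hlim : Tendsto (fun n : ℕ => entropy A * (n : ℝ≥0∞)⁻¹) atTop (𝓝 (entropy A * 0)) :=
    ENNReal.Tendsto.const_mul ENNReal.tendsto_inv_nat_nhds_zero
      (Or.inr (entropy_of_ne_top hA ▸ ENNReal.ofReal_ne_top))
  rw [mul_zero] at hlim
  refine le_antisymm (le_of_tendsto_of_tendsto (tendsto_mapEntropy id A) hlim ?_) zero_le
  filter_upwards [eventually_ge_atTop 1] with n hn
  obtain ⟨n, rfl⟩ := Nat.exists_eq_add_of_le' hn
  exact ENNReal.div_le_div_right (entropy_mono (hle n)) _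

end CoverEntropy

theorem mainTheorem3 {X : Type*} [TopologicalSpace X] [TopologicalSpace.MetrizableSpace X]
    [LocallyCompactSpace X] [TopologicalSpace.SeparableSpace X]
    (T : X → X) (hT : Continuous T) (k : ℕ) :
    CoverEntropy.topEntropy (T^[k]) = (k : ℝ≥0∞) * CoverEntropy.topEntropy T := by
  rcases k with _ | k
  · rw [Nat.cast_zero, zero_mul, Function.iterate_zero]
    exact ENNReal.iSup_eq_zero.mpr fun A => ENNReal.iSup_eq_zero.mpr fun hA =>
      CoverEntropy.mapEntropy_id hA.minCard_ne_top
  · refine le_antisymm (iSup₂_le fun A hA => ?_) ?_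
    · exact (CoverEntropy.mapEntropy_iterate_le T A k).trans
        (mul_le_mul_right (le_iSup₂ (f := fun A _ => CoverEntropy.mapEntropy T A) A hA) _)
    · simp only [CoverEntropy.topEntropy, ENNReal.mul_iSup]
      exact iSup₂_le fun A hA => CoverEntropy.mul_mapEntropy_le_topEntropy_iterate hT hA k
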